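/- For a set $I$, let $\mathcal B(I)$ be the Maharam measure algebra with free basis indexed by $I$: the measure algebra (measurable sets modulo null sets) of $\{0,1\}^I$ with the product $\sigma$-algebra and the product of the fair coin-tossing measures; $\mathrm{Leb}$ denotes its measure. A subset $Y$ of a Boolean algebra is independent if for any distinct $y_1,\dots,y_n\in Y$ and any signs $\eta_1,\dots,\eta_n\in\{0,1\}$ we have $\bigcap_{k\le n} y_k^{[\eta_k]}\neq 0$, where $y^{[1]}=y$ and $y^{[0]}=-y$. A cardinal $\lambda$ is a free caliber of a Boolean algebra $B$ if every $X\subseteq B$ with $|X|=\lambda$ has an independent subset $Y\subseteq X$ with $|Y|=\lambda$. Let $\mathcal B=\mathcal B(I)$ for some set $I$, and let $\lambda,\mu$ be cardinals with $\beth_2\le\mu=\mu^{\aleph_0}<\mathrm{cf}(\lambda)\le\lambda\le 2^\mu$. If $a_\alpha\in\mathcal B$ ($\alpha<\lambda$) are pairwise distinct with $\mathrm{Leb}(a_\alpha)>0$, then there is $X\subseteq\lambda$ with $|X|=\lambda$ such that for all distinct $\alpha_1,\dots,\alpha_n\in X$ and all $\eta_1,\dots,\eta_n\in\{0,1\}$,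 $$\mathrm{Leb}\Big(\bigcap_{k\le n}a_{\alpha_k}^{[\eta_k]}\Big)>0 .$$ Moreover, $\lambda$ is a free caliber of $\mathcal B$. -/

import Mathlib

open Cardinal Ordinal MeasureTheory
open scoped ENNReal

universe u

/-! ### The measure algebra of a measure space -/

/-- Equality of measurable sets modulo null sets. -/
def nullSetoid {Ω : Type u} [MeasurableSpace Ω] (P : Measure Ω) :
    Setoid {s : Set Ω // MeasurableSet s} where
  r s t := (s : Set Ω) =ᵐ[P] (t : Set Ω)
  iseqv := ⟨fun _ => Filter.EventuallyEq.rfl, fun h => h.symm, fun h k => h.trans k⟩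

/-- The measure algebra of `P`: measurable sets modulo `P`-null sets. -/
def MeasAlg {Ω : Type u} [MeasurableSpace Ω] (P : Measure Ω) : Type u :=
  Quotient (nullSetoid P)

namespace MeasAlg

variable {Ω : Type u} [MeasurableSpace Ω] {P : Measure Ω}

/-- The class of a measurable set. -/
def mk (P : Measure Ω) (s : {s : Set Ω // MeasurableSet s}) : MeasAlg P :=
  Quotient.mk (nullSetoid P) s

theorem mk_eq_mk {s t : {s : Set Ω // MeasurableSet s}} :
    mk P s = mk P t ↔ (s : Set Ω) =ᵐ[P] (t : Set Ω) :=
  Quotient.eq (r := nullSetoid P)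

theorem ind {p : MeasAlg P → Prop} (h : ∀ s, p (mk P s)) (a : MeasAlg P) : p a :=
  Quotient.ind (s := nullSetoid P) h a

/-- The Boolean algebra structure induced by the set operations on representatives;
`a ≤ b` means that a representative of `a` is contained in one of `b` up to a null set. -/
instance instBooleanAlgebra : BooleanAlgebra (MeasAlg P) where
  le a b := Quotient.liftOn₂' a b (s₁ := nullSetoid P) (s₂ := nullSetoid P)
    (fun s t => (s : Set Ω) ≤ᵐ[P] (t : Set Ω))
    (fun _ _ _ _ h k => propext
      ⟨fun l => h.symm.le.trans (l.trans k.le), fun l => h.le.trans (l.trans k.symm.le)⟩)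
  le_refl a := by
    induction a using ind with | _ s
    exact Filter.EventuallyLE.refl (ae P) (s : Set Ω)
  le_trans a b c := by
    induction a using ind with | _ s
    induction b using ind with | _ t
    induction c using ind with | _ w
    exact fun h k => Filter.EventuallyLE.trans h k
  le_antisymm a b := by
    induction a using ind with | _ s
    induction b using ind with | _ t
    exact fun h k => mk_eq_mk.2 (Filter.EventuallyLE.antisymm h k)
  sup a b := Quotient.map₂ (sa := nullSetoid P) (sb := nullSetoid P) (sc := nullSetoid P)
    (fun s t => s ⊔ t) (fun _ _ h _ _ k => Filter.EventuallyEq.union h k) a b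
  inf a b := Quotient.map₂ (sa := nullSetoid P) (sb := nullSetoid P) (sc := nullSetoid P)
    (fun s t => s ⊓ t) (fun _ _ h _ _ k => Filter.EventuallyEq.inter h k) a b
  compl a := Quotient.map (sa := nullSetoid P) (sb := nullSetoid P)
    (fun s => sᶜ) (fun _ _ h => Filter.EventuallyEq.compl h) a
  sdiff a b := Quotient.map₂ (sa := nullSetoid P) (sb := nullSetoid P) (sc := nullSetoid P)
    (fun s t => s ⊓ tᶜ) (fun _ _ h _ _ k => Filter.EventuallyEq.inter h k.compl) a b
  himp a b := Quotient.map₂ (sa := nullSetoid P) (sb := nullSetoid P) (sc := nullSetoid P)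
    (fun s t => t ⊔ sᶜ) (fun _ _ h _ _ k => Filter.EventuallyEq.union k h.compl) a b
  top := mk P ⊤
  bot := mk P ⊥
  le_sup_left a b := by
    induction a using ind with | _ s
    induction b using ind with | _ t
    exact Filter.Eventually.of_forall fun _ h => Or.inl h
  le_sup_right a b := by
    induction a using ind with | _ s
    induction b using ind with | _ t
    exact Filter.Eventually.of_forall fun _ h => Or.inr h
  sup_le a b c := by
    induction a using ind with | _ s
    induction b using ind with | _ t
    induction c using ind with | _ w
    intro h k
    have h' : (s : Set Ω) ≤ᵐ[P] (w : Set Ω) := h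
    have k' : (t : Set Ω) ≤ᵐ[P] (w : Set Ω) := k
    change ((s : Set Ω) ∪ (t : Set Ω) : Set Ω) ≤ᵐ[P] (w : Set Ω)
    filter_upwards [h', k'] with x hx kx hxx
    exact hxx.elim hx kx
  inf_le_left a b := by
    induction a using ind with | _ s
    induction b using ind with | _ t
    exact Filter.Eventually.of_forall fun _ h => h.1
  inf_le_right a b := by
    induction a using ind with | _ s
    induction b using ind with | _ t
    exact Filter.Eventually.of_forall fun _ h => h.2
  le_inf a b c := by
    induction a using ind with | _ s
    induction b using ind with | _ t
    induction c using ind with | _ w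
    intro h k
    have h' : (s : Set Ω) ≤ᵐ[P] (t : Set Ω) := h
    have k' : (s : Set Ω) ≤ᵐ[P] (w : Set Ω) := k
    change (s : Set Ω) ≤ᵐ[P] ((t : Set Ω) ∩ (w : Set Ω) : Set Ω)
    filter_upwards [h', k'] with x hx kx hxx
    exact ⟨hx hxx, kx hxx⟩
  le_sup_inf a b c := by
    induction a using ind with | _ s
    induction b using ind with | _ t
    induction c using ind with | _ w
    refine Filter.Eventually.of_forall fun x h => ?_
    obtain ⟨h1 | h1, h2⟩ := h
    · exact Or.inl h1
    · exact h2.elim Or.inl fun h2 => Or.inr ⟨h1, h2⟩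
  le_top a := by
    induction a using ind with | _ s
    exact Filter.Eventually.of_forall fun _ _ => trivial
  bot_le a := by
    induction a using ind with | _ s
    exact Filter.Eventually.of_forall fun _ h => False.elim h
  inf_compl_le_bot a := by
    induction a using ind with | _ s
    exact Filter.Eventually.of_forall fun _ h => h.2 h.1
  top_le_sup_compl a := by
    induction a using ind with | _ s
    exact Filter.Eventually.of_forall fun x _ => Classical.em (x ∈ (s : Set Ω))
  sdiff_eq a b := by
    induction a using ind with | _ s
    induction b using ind with | _ t
    rfl
  himp_eq a b := by
    induction a using ind with | _ s
    induction b using ind with | _ t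
    rfl

/-- The measure of an element of the measure algebra. -/
def leb (a : MeasAlg P) : ℝ≥0∞ :=
  Quotient.liftOn (s := nullSetoid P) a (fun s => P (s : Set Ω)) fun _ _ h => measure_congr h

theorem leb_mk (s : {s : Set Ω // MeasurableSet s}) : leb (mk P s) = P (s : Set Ω) := rfl

theorem mk_inf (s t : {s : Set Ω // MeasurableSet s}) : mk P s ⊓ mk P t = mk P (s ⊓ t) := rfl

theorem mk_sup (s t : {s : Set Ω // MeasurableSet s}) : mk P s ⊔ mk P t = mk P (s ⊔ t) := rfl

theorem mk_compl (s : {s : Set Ω // MeasurableSet s}) : (mk P s)ᶜ = mk P sᶜ := rfl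

theorem mk_le_mk (s t : {s : Set Ω // MeasurableSet s}) :
    mk P s ≤ mk P t ↔ (s : Set Ω) ≤ᵐ[P] (t : Set Ω) := Iff.rfl

theorem leb_pos_iff (a : MeasAlg P) : 0 < leb a ↔ a ≠ ⊥ := by
  induction a using ind with | _ s
  rw [leb_mk, pos_iff_ne_zero, not_iff_not]
  exact ae_eq_empty.symm.trans (mk_eq_mk (P := P) (t := ⊥)).symm

end MeasAlg

/-! ### Maharam measure algebras -/

/-- The fair coin-tossing probability measure on the two-point space. -/
noncomputable def coin : Measure Bool :=
  (2⁻¹ : ℝ≥0∞) • (Measure.dirac true + Measure.dirac false)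

instance coin_isProbabilityMeasure : IsProbabilityMeasure coin :=
  ⟨by simp [coin, ENNReal.inv_two_add_inv_two]⟩

/-- The Maharam measure algebra with free basis indexed by `I`: the measure algebra of the
product of `I` copies of the fair coin-tossing measure. Its basis consists of the classes of the
sets `{ω | ω i = true}`, `i : I`. -/
abbrev MaharamAlgebra (I : Type u) : Type u :=
  MeasAlg (Measure.infinitePi fun _ : I => coin)

/-! ### Independence and free calibers -/

/-- A subset `Y` of a Boolean algebra is independent if for any finitely many distinct members,
the meet of these members, each either complemented or not, is nonzero. -/
def BoolIndependent {B : Type u} [BooleanAlgebra B] (Y : Set B) : Prop :=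
  ∀ (s : Finset B) (η : B → Bool), (s : Set B) ⊆ Y →
    s.inf (fun y => if η y then y else yᶜ) ≠ ⊥

/-- `κ` is a free caliber of `B`: every subset of `B` of cardinality `κ` includes an
independent subset of cardinality `κ`. -/
def IsFreeCaliber (B : Type u) [BooleanAlgebra B] (κ : Cardinal.{u}) : Prop :=
  ∀ X : Set B, #X = κ → ∃ Y : Set B, Y ⊆ X ∧ #Y = κ ∧ BoolIndependent Y

/-!
Let `λ` elements of the Maharam algebra be given. Each of them is the class of a set
`{z | z ∘ x ∈ A}` for an injective sequence `x : ℕ → I` of coordinates and a measurable set `A` of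
binary sequences (`exists_comp_mem_iff`). Since the cofinality of `λ` exceeds `μ = μ ^ ℵ₀` and
`λ ≤ 2 ^ μ`, after passing to `λ` many elements the set `A` is always the same and the sequences
are sections of one colouring `c` of the coordinates: `c (x n) = n` (`exists_colouring`).
Sequences of different elements can therefore meet only at equal indices.

Call `n` essential if flipping the `n`-th term changes membership in `A` with positive
probability. The element is determined by the restriction of `x` to the essential indices
(`comp_mem_ae_iff_of_eqOn_essentialCoords`), so these restrictions are distinct. A compactness
argument over the at most `ℶ_ 2` ultrafilters on the essential indices gives one ultrafilter
modulo which `λ` many of them remain distinct (`exists_ultrafilter_separating`). For finitely many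
of these there is a single essential `n` at which all the sequences take distinct values.

Such a finite family is independent (`measure_pattern_ne_zero`). With positive probability every
member is sensitive to a flip of its own `n`-th coordinate (`measure_forall_comp_mem_ne_zero`);
these coordinates are distinct and no member uses the `n`-th coordinate of another one, so
flipping some of them produces any prescribed pattern. Null sets are harmless throughout because
changing finitely many coordinates does not lead into a null set
(`ae_forall_eqOn_compl_notMem`).
-/

/-! ### The coin-tossing measure on `J → Bool` -/

/-- The product of `J` copies of the fair coin-tossing measure. -/
noncomputable abbrev coinProd (J : Type*) : Measure (J → Bool) :=
  Measure.infinitePi fun _ : J => coin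

theorem map_coin_of_involutive {f : Bool → Bool} (hf : f.Involutive) : coin.map f = coin := by
  have hm : Measurable f := measurable_of_countable f
  have h : f true = true ∧ f false = false ∨ f true = false ∧ f false = true := by
    have h₁ := hf true
    have h₂ := hf false
    cases h₃ : f true <;> cases h₄ : f false <;> simp_all
  rw [coin, Measure.map_smul, Measure.map_add _ _ hm, Measure.map_dirac' hm, Measure.map_dirac' hm]
  obtain ⟨h₁, h₂⟩ | ⟨h₁, h₂⟩ := h
  · rw [h₁, h₂]
  · rw [h₁, h₂, add_comm]

open scoped Classical in
/-- Reversing the outcomes at a fixed set of coordinates. -/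
noncomputable def flipOn {J : Type*} (S : Set J) (z : J → Bool) : J → Bool :=
  fun i => if i ∈ S then !z i else z i

open scoped Classical in
theorem measurePreserving_flipOn {J : Type*} (S : Set J) :
    MeasurePreserving (flipOn S) (coinProd J) (coinProd J) := by
  refine ⟨?_, ?_⟩
  · unfold flipOn
    fun_prop
  · have h := Measure.infinitePi_map_pi (fun _ : J => coin)
      (f := fun (i : J) (b : Bool) => if i ∈ S then !b else b) fun _ => measurable_of_countable _
    refine h.trans ?_
    congr 1
    funext i
    refine map_coin_of_involutive fun b => ?_
    by_cases hi : i ∈ S <;> simp [hi]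

/-- Changing finitely many coordinates, even in a way that depends on the point, does not lead
into a null set: the result is one of finitely many measure preserving flips of the point. -/
theorem ae_forall_eqOn_compl_notMem {J : Type*} {G : Set (J → Bool)} (hG : coinProd J G = 0)
    (T : Finset J) :
    ∀ᵐ z ∂coinProd J, ∀ z' : J → Bool, (∀ i ∉ T, z' i = z i) → z' ∉ G := by
  classical
  have h : ∀ᵐ z ∂coinProd J, ∀ S ∈ T.powerset, flipOn (S : Set J) z ∉ G := by
    rw [Finset.eventually_all]
    intro S _
    exact (measurePreserving_flipOn (S : Set J)).quasiMeasurePreserving.ae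
      (measure_eq_zero_iff_ae_notMem.1 hG)
  filter_upwards [h] with z hz z' hz'
  have h₁ := hz (T.filter fun i => z' i ≠ z i) (by simp)
  convert h₁ using 2
  funext i
  by_cases hi : i ∈ T
  · cases h₂ : z' i <;> cases h₃ : z i <;> simp [flipOn, hi, h₂, h₃]
  · simp [flipOn, hi, hz' i hi]

theorem measurePreserving_comp_injective {J K : Type*} {x : K → J} (hx : x.Injective) :
    MeasurePreserving (fun z : J → Bool => z ∘ x) (coinProd J) (coinProd K) := by
  classical
  have hm : Measurable fun z : J → Bool => z ∘ x := by
    unfold Function.comp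
    fun_prop
  refine ⟨hm, Measure.eq_infinitePi _ fun s t ht => ?_⟩
  rw [Measure.map_apply hm (.pi s.countable_toSet fun i _ => ht i)]
  have h : (fun z : J → Bool => z ∘ x) ⁻¹' (s : Set K).pi t
      = ((s.map ⟨x, hx⟩ : Finset J) : Set J).pi (Function.extend x t fun _ => Set.univ) := by
    ext z
    simp [Set.mem_pi, hx.extend_apply]
  rw [h, Measure.infinitePi_pi]
  · simp [hx.extend_apply]
  · intro i hi
    obtain ⟨k, _, rfl⟩ := Finset.mem_map.1 hi
    simp [hx.extend_apply]

theorem dependsOn_of_mem_measurableCylinders {C : Set (ℕ → Bool)}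
    (hC : C ∈ measurableCylinders fun _ : ℕ => Bool) :
    ∃ N : ℕ, ∀ p q : ℕ → Bool, (∀ n < N, p n = q n) → (p ∈ C ↔ q ∈ C) := by
  obtain ⟨s, S, _, rfl⟩ := (mem_measurableCylinders _).1 hC
  obtain ⟨N, hN⟩ := s.exists_nat_subset_range
  refine ⟨N, fun p q h => ?_⟩
  have : s.restrict p = s.restrict q := by
    funext i
    exact h i (Finset.mem_range.1 (hN i.2))
  rw [mem_cylinder, mem_cylinder, this]

theorem exists_cylinder_approx {A : Set (ℕ → Bool)} (hA : MeasurableSet A) {ε : ℝ≥0∞}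
    (hε : 0 < ε) :
    ∃ C : Set (ℕ → Bool), MeasurableSet C ∧
      (∃ N : ℕ, ∀ p q : ℕ → Bool, (∀ n < N, p n = q n) → (p ∈ C ↔ q ∈ C)) ∧
      coinProd ℕ (symmDiff C A) < ε := by
  obtain ⟨C, hC, h⟩ := exists_measure_symmDiff_lt_of_generateFrom_isSetRing
    (μ := coinProd ℕ) (C := measurableCylinders fun _ : ℕ => Bool) isSetRing_measurableCylinders
    ⟨{Set.univ}, Set.countable_singleton _,
      Set.singleton_subset_iff.2 (univ_mem_measurableCylinders _), by simp⟩
    generateFrom_measurableCylinders.symm hA hε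
  exact ⟨C, .of_mem_measurableCylinders hC, dependsOn_of_mem_measurableCylinders hC, h⟩

/-! ### Pulling back a set of binary sequences along sections of a colouring -/

/-- The coordinates on which `A` depends modulo null sets. -/
def essentialCoords (A : Set (ℕ → Bool)) : Set ℕ :=
  {n | ¬ ∀ᵐ p ∂coinProd ℕ, flipOn {n} p ∈ A ↔ p ∈ A}

theorem flipOn_singleton_of_eq_false {J : Type*} [DecidableEq J] {i : J} {p : J → Bool}
    (h : p i = false) : flipOn {i} p = Function.update p i true := by
  funext j
  by_cases hj : j = i
  · subst hj
    simp [flipOn, h]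
  · simp [flipOn, hj]

section Pullback

variable {J : Type*} {A : Set (ℕ → Bool)}

/-- Off the essential coordinates of `A`, membership in `A` is unchanged when the `n`-th value is
set to `true`, hence does not depend on where that value is read. -/
theorem comp_mem_ae_iff_of_eq_off {x x' : ℕ → J} (hx : x.Injective) (hx' : x'.Injective)
    {n : ℕ} (hn : n ∉ essentialCoords A) (h : ∀ m, m ≠ n → x m = x' m) :
    ∀ᵐ z ∂coinProd J, z ∘ x ∈ A ↔ z ∘ x' ∈ A := by
  have hA : ∀ᵐ p ∂coinProd ℕ, p ∈ A ↔ Function.update p n true ∈ A := by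
    filter_upwards [not_not.1 hn] with p hp
    cases hpn : p n
    · rw [← hp, flipOn_singleton_of_eq_false hpn]
    · rw [← hpn, Function.update_eq_self]
  filter_upwards [(measurePreserving_comp_injective hx).quasiMeasurePreserving.ae hA,
    (measurePreserving_comp_injective hx').quasiMeasurePreserving.ae hA] with z h₁ h₂
  have h₃ : Function.update (z ∘ x) n true = Function.update (z ∘ x') n true := by
    funext m
    by_cases hm : m = n
    · subst hm
      simp
    · simp [hm, h m hm]
  rw [h₁, h₂, h₃]

variable {c : J → ℕ}

theorem injective_of_colour {x : ℕ → J} (hx : ∀ n, c (x n) = n) : x.Injective :=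
  Function.LeftInverse.injective hx

/-- The sequence that follows `x` before `N` and `x'` from `N` on. -/
def splice (x x' : ℕ → J) (N : ℕ) (n : ℕ) : J := if n < N then x n else x' n

theorem colour_splice {x x' : ℕ → J} (hx : ∀ n, c (x n) = n) (hx' : ∀ n, c (x' n) = n)
    (N n : ℕ) : c (splice x x' N n) = n := by
  unfold splice
  split_ifs
  exacts [hx n, hx' n]

/-- Finitely many coordinates can be exchanged one at a time; the remaining ones are negligible
because `A` is approximated by sets depending on finitely many coordinates. -/
theorem comp_mem_ae_iff_of_eqOn_essentialCoords (hA : MeasurableSet A) {x x' : ℕ → J}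
    (hx : ∀ n, c (x n) = n) (hx' : ∀ n, c (x' n) = n)
    (h : ∀ n ∈ essentialCoords A, x n = x' n) :
    ∀ᵐ z ∂coinProd J, z ∘ x ∈ A ↔ z ∘ x' ∈ A := by
  have hinj (N : ℕ) : (splice x x' N).Injective := injective_of_colour (colour_splice hx hx' N)
  have hN (N : ℕ) : ∀ᵐ z ∂coinProd J, z ∘ splice x x' N ∈ A ↔ z ∘ x' ∈ A := by
    induction N with
    | zero =>
      have : splice x x' 0 = x' := by
        funext n
        simp [splice]
      simp [this]
    | succ N ih =>
      have hs : ∀ᵐ z ∂coinProd J, z ∘ splice x x' (N + 1) ∈ A ↔ z ∘ splice x x' N ∈ A := by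
        by_cases hNA : N ∈ essentialCoords A
        · refine .of_forall fun z => ?_
          have : splice x x' (N + 1) = splice x x' N := by
            funext n
            rcases lt_trichotomy n N with hn | rfl | hn
            · simp [splice, hn, Nat.lt_succ_of_lt hn]
            · simp [splice, h n hNA]
            · simp [splice, hn.not_gt, show ¬ n < N + 1 by omega]
          rw [this]
        · refine comp_mem_ae_iff_of_eq_off (hinj _) (hinj _) hNA fun m hm => ?_
          have : m < N + 1 ↔ m < N := by omega
          simp [splice, this]
      filter_upwards [hs, ih] with z h₁ h₂
      rw [h₁, h₂]
  have hmp {y : ℕ → J} (hy : y.Injective) {B : Set (ℕ → Bool)} (hB : MeasurableSet B) :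
      coinProd J {z | z ∘ y ∈ B} = coinProd ℕ B :=
    (measurePreserving_comp_injective hy).measure_preimage hB.nullMeasurableSet
  rw [ae_iff]
  refine nonpos_iff_eq_zero.1 (le_of_forall_gt_imp_ge_of_dense fun ε hε => ?_)
  obtain ⟨C, hC, ⟨N, hCN⟩, hCA⟩ := exists_cylinder_approx hA (ENNReal.half_pos hε.ne')
  have hD := hC.symmDiff hA
  calc coinProd J {z | ¬(z ∘ x ∈ A ↔ z ∘ x' ∈ A)}
      ≤ coinProd J ({z | z ∘ x ∈ symmDiff C A} ∪ {z | z ∘ splice x x' N ∈ symmDiff C A}) := by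
        refine measure_mono_ae ?_
        filter_upwards [hN N] with z hz h₁
        have h₂ := hCN (z ∘ x) (z ∘ splice x x' N) fun n hn => by simp [splice, hn]
        change ¬ _ at h₁
        rw [← hz] at h₁
        change z ∘ x ∈ symmDiff C A ∨ z ∘ splice x x' N ∈ symmDiff C A
        simp only [Set.mem_symmDiff]
        tauto
    _ ≤ coinProd ℕ (symmDiff C A) + coinProd ℕ (symmDiff C A) := by
        refine (measure_union_le _ _).trans_eq ?_
        rw [hmp (injective_of_colour hx) hD, hmp (hinj N) hD]
    _ ≤ ε / 2 + ε / 2 := add_le_add hCA.le hCA.le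
    _ = ε := ENNReal.add_halves ε

variable {ι : Type*}

/-- A set of positive measure is met simultaneously by finitely many sections of a colouring,
however they overlap. The set nearly depends on finitely many coordinates only, and making
all sections agree with one of them on these coordinates is a change at finitely many places. -/
theorem measure_forall_comp_mem_ne_zero {U : Set (ℕ → Bool)} (hU : MeasurableSet U)
    (hU₀ : coinProd ℕ U ≠ 0) (F : Finset ι) {x : ι → ℕ → J} (hx : ∀ α n, c (x α n) = n) :
    coinProd J {z | ∀ α ∈ F, z ∘ x α ∈ U} ≠ 0 := by
  classical
  intro hG
  obtain rfl | ⟨α₀, _⟩ := F.eq_empty_or_nonempty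
  · simp at hG
  obtain ⟨C, hC, ⟨N, hCN⟩, hCU⟩ := exists_cylinder_approx hU
    (ENNReal.div_pos hU₀ (ENNReal.natCast_ne_top (F.card + 1)))
  have hD := hC.symmDiff hU
  have hmp {y : ℕ → J} (hy : ∀ n, c (y n) = n) :
      coinProd J {z | z ∘ y ∈ symmDiff C U} = coinProd ℕ (symmDiff C U) :=
    (measurePreserving_comp_injective (injective_of_colour hy)).measure_preimage
      hD.nullMeasurableSet
  -- `Φ z` copies the values of `z` along `x α₀` onto the first `N` terms of every section, so that
  -- along `x α` it looks like `z` along a splice of `x α₀` and `x α`.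
  let T : Finset J := (F ×ˢ Finset.range N).image fun q => x q.1 q.2
  let Φ (z : J → Bool) (i : J) : Bool := if i ∈ T then z (x α₀ (c i)) else z i
  have hΦ (z : J → Bool) {α : ι} (hα : α ∈ F) : Φ z ∘ x α = z ∘ splice (x α₀) (x α) N := by
    funext n
    have hT : x α n ∈ T ↔ n < N := by
      constructor
      · intro h
        obtain ⟨⟨β, m⟩, hβ, h⟩ := Finset.mem_image.1 h
        have hmn : m = n := by rw [← hx β m, ← hx α n]; exact congrArg c h
        exact hmn ▸ Finset.mem_range.1 (Finset.mem_product.1 hβ).2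
      · intro h
        exact Finset.mem_image.2 ⟨(α, n), by simp [hα, h], rfl⟩
    by_cases hn : n < N <;> simp [Φ, hT, hn, splice, hx]
  have key : coinProd ℕ U ≤ (F.card + 1 : ℕ) * coinProd ℕ (symmDiff C U) :=
    calc coinProd ℕ U
        = coinProd J {z | z ∘ x α₀ ∈ U} :=
          ((measurePreserving_comp_injective (injective_of_colour (hx α₀))).measure_preimage
            hU.nullMeasurableSet).symm
      _ ≤ coinProd J ({z | z ∘ x α₀ ∈ symmDiff C U} ∪
            ⋃ α ∈ F, {z | z ∘ splice (x α₀) (x α) N ∈ symmDiff C U}) := by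
          refine measure_mono_ae ?_
          filter_upwards [ae_forall_eqOn_compl_notMem hG T] with z hz hzU
          have h₁ := hz (Φ z) fun i hi => by simp [Φ, hi]
          simp only [not_forall] at h₁
          obtain ⟨α, hα, h₁⟩ := h₁
          rw [hΦ z hα] at h₁
          have h₂ := hCN (z ∘ x α₀) (z ∘ splice (x α₀) (x α) N) fun n hn => by simp [splice, hn]
          change z ∘ x α₀ ∈ U at hzU
          change _ ∨ _
          by_cases h₃ : z ∘ x α₀ ∈ C
          · right
            simp only [Set.mem_iUnion]
            exact ⟨α, hα, Or.inl ⟨h₂.1 h₃, h₁⟩⟩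
          · exact Or.inl (Or.inr ⟨hzU, h₃⟩)
      _ ≤ coinProd ℕ (symmDiff C U) + ∑ α ∈ F, coinProd ℕ (symmDiff C U) := by
          refine (measure_union_le _ _).trans (add_le_add (hmp (hx α₀)).le ?_)
          refine (measure_biUnion_finset_le _ _).trans (Finset.sum_le_sum fun α _ => ?_)
          exact (hmp (colour_splice (hx α₀) (hx α) N)).le
      _ = (F.card + 1 : ℕ) * coinProd ℕ (symmDiff C U) := by
          rw [Finset.sum_const, _root_.nsmul_eq_mul, Nat.cast_succ]
          ring
  exact (key.trans_lt (ENNReal.mul_lt_of_lt_div' hCU)).false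

/-- If finitely many sections take distinct values at an essential coordinate `n` of `A`, then
flipping these values one by one realizes every pattern of membership in `A`, starting from a
point at which all the sections are sensitive to the flip. -/
theorem measure_pattern_ne_zero (hA : MeasurableSet A) (F : Finset ι) {x : ι → ℕ → J}
    (hx : ∀ α n, c (x α n) = n) {n : ℕ} (hn : n ∈ essentialCoords A)
    (hF : ∀ α ∈ F, ∀ β ∈ F, x α n = x β n → α = β) (η : ι → Bool) :
    coinProd J {z | ∀ α ∈ F, (z ∘ x α ∈ A ↔ η α = true)} ≠ 0 := by
  classical
  intro hG
  have hU : MeasurableSet {p : ℕ → Bool | ¬(flipOn {n} p ∈ A ↔ p ∈ A)} :=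
    (((measurePreserving_flipOn {n}).measurable hA).iff hA).compl
  have hE := measure_forall_comp_mem_ne_zero hU (by simpa [essentialCoords, ae_iff] using hn) F hx
  obtain ⟨z, hzE, hz⟩ := ((frequently_ae_mem_iff.2 hE).and_eventually
    (ae_forall_eqOn_compl_notMem hG (F.image fun α => x α n))).exists
  -- Flip the `n`-th coordinate of exactly those members that do not yet follow the pattern.
  let S : Set J := {i | ∃ α ∈ F, i = x α n ∧ ¬(z ∘ x α ∈ A ↔ η α = true)}
  refine hz (flipOn S z) (fun i hi => ?_) fun α hα => ?_
  · have : i ∉ S := by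
      rintro ⟨α, hα, rfl, -⟩
      exact hi (Finset.mem_image_of_mem _ hα)
    simp [flipOn, this]
  · have hS (m : ℕ) : x α m ∈ S ↔ m = n ∧ ¬(z ∘ x α ∈ A ↔ η α = true) := by
      constructor
      · rintro ⟨β, hβ, h, h'⟩
        have hmn : m = n := by rw [← hx α m, ← hx β n, h]
        subst hmn
        rw [hF α hα β hβ h]
        exact ⟨rfl, h'⟩
      · rintro ⟨rfl, h⟩
        exact ⟨α, hα, rfl, h⟩
    have h₁ : ¬(flipOn {n} (z ∘ x α) ∈ A ↔ z ∘ x α ∈ A) := hzE α hα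
    by_cases h : z ∘ x α ∈ A ↔ η α = true
    · have : flipOn S z ∘ x α = z ∘ x α := by
        funext m
        simp [flipOn, hS, h]
      rw [this]
      exact h
    · have : flipOn S z ∘ x α = flipOn {n} (z ∘ x α) := by
        funext m
        by_cases hm : m = n <;> simp [flipOn, hS, h, hm]
      rw [this]
      tauto

end Pullback

/-! ### Separating sequences by an ultrafilter -/

theorem mk_ultrafilter_le_beth_two (V : Type) [Countable V] : #(Ultrafilter V) ≤ ℶ_ 2 := by
  have h₁ : #(Ultrafilter V) ≤ #(Set (Set V)) :=
    mk_le_of_injective (f := fun D : Ultrafilter V => (D : Filter V).sets) fun D E h =>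
      Ultrafilter.coe_injective (Filter.filter_eq h)
  have h₂ : ℶ_ 2 = 2 ^ (2 ^ ℵ₀ : Cardinal.{0}) := by
    rw [← one_add_one_eq_two, beth_add_one, ← zero_add (1 : Ordinal), beth_add_one, beth_zero]
  rw [mk_set, mk_set] at h₁
  rw [h₂]
  have h₃ := mk_le_aleph0 (α := V)
  exact h₁.trans (power_le_power_left two_ne_zero (power_le_power_left two_ne_zero h₃))

theorem mk_fun_nat_le_beth_two (V : Type) [Countable V] : #(V → ℕ) ≤ ℶ_ 2 := by
  have h : #(V → ℕ) ≤ ℶ_ 1 := by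
    rw [← power_def, mk_nat, beth_one, ← aleph0_power_aleph0]
    exact power_le_power_left aleph0_ne_zero mk_le_aleph0
  exact h.trans (beth_mono (by norm_num))

theorem mk_iUnion_lt_of_lt_cof {ι K : Type u} {R : K → Set ι} (hι : ℵ₀ ≤ #ι)
    (hK : #K < (#ι).ord.cof) (hR : ∀ k, #(R k) < #ι) : #(⋃ k, R k) < #ι :=
  (mk_iUnion_le R).trans_lt
    (mul_lt_of_lt hι (hK.trans_le (cof_ord_le _)) (iSup_lt_of_lt_cof_ord hK hR))

/-- If every ultrafilter identifies `x α` with some `x r`, `r ∈ R`, then by compactness `x α` is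
pieced together from finitely many of the `x r`. -/
theorem exists_list_of_forall_ultrafilter {ι Y : Type*} {V : Type*} {x : ι → V → Y} {R : Set ι}
    {α : ι} (h : ∀ D : Ultrafilter V, ∃ r ∈ R, ∀ᶠ n in D, x α n = x r n) :
    ∃ (l : List R) (g : V → ℕ), ∀ n, ∃ r : R, l[g n]? = some r ∧ x α n = x r n := by
  classical
  suffices ∃ s : Finset R, ∀ n, ∃ r ∈ s, x α n = x r n by
    obtain ⟨s, hs⟩ := this
    have h₁ (n : V) : ∃ (k : ℕ) (r : R), s.toList[k]? = some r ∧ x α n = x r n := by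
      obtain ⟨r, hr, h⟩ := hs n
      obtain ⟨k, hk⟩ := List.mem_iff_getElem?.1 (Finset.mem_toList.2 hr)
      exact ⟨k, r, hk, h⟩
    choose g hg using h₁
    exact ⟨s.toList, g, hg⟩
  by_contra! hcon
  obtain ⟨D, hD⟩ := Ultrafilter.exists_ultrafilter_of_finite_inter_nonempty
    ((fun r : R => {n | x α n ≠ x r n}) '' Set.univ) fun T hT => by
      obtain ⟨s, -, rfl⟩ := Finset.subset_set_image_iff.1 hT
      obtain ⟨n, hn⟩ := hcon s
      refine ⟨n, ?_⟩
      rintro _ ht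
      obtain ⟨r, hr, rfl⟩ := Finset.mem_image.1 (Finset.mem_coe.1 ht)
      exact hn r hr
  obtain ⟨r, hr, h₁⟩ := h D
  have h₂ : ∀ᶠ n in D, x α n ≠ x r n := hD ⟨⟨r, hr⟩, trivial, rfl⟩
  obtain ⟨n, h₃, h₄⟩ := (h₁.and h₂).exists
  exact h₄ h₃

/-- Many distinct sequences remain distinct modulo a single ultrafilter. Otherwise, choosing
representatives modulo each of the at most `ℶ_ 2` ultrafilters gives a set of fewer than `#ι`
sequences from which all the others can be pieced together. -/
theorem exists_ultrafilter_separating {ι Y : Type u} {V : Type} [Countable V] {x : ι → V → Y}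
    (hx : x.Injective) (hι : ℶ_ 2 < (#ι).ord.cof) :
    ∃ (D : Ultrafilter V) (X : Set ι), #X = #ι ∧
      ∀ α ∈ X, ∀ β ∈ X, α ≠ β → ∀ᶠ n in D, x α n ≠ x β n := by
  by_contra! hcon
  have hι₂ : ℶ_ 2 < #ι := hι.trans_le (cof_ord_le _)
  have hι₀ : ℵ₀ ≤ #ι := (aleph0_le_beth 2).trans hι₂.le
  let r (D : Ultrafilter V) : Setoid ι :=
    { r := fun α β => ∀ᶠ n in D, x α n = x β n
      iseqv := ⟨fun _ => .of_forall fun _ => rfl, fun h => h.mono fun _ => Eq.symm,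
        fun h k => (h.and k).mono fun _ h => h.1.trans h.2⟩ }
  let R (D : ULift.{u} (Ultrafilter V)) : Set ι := Set.range (Quotient.out (s := r D.down))
  have hR (D) : #(R D) < #ι := by
    refine lt_of_le_of_ne (mk_set_le _) fun h => ?_
    obtain ⟨_, ⟨p, rfl⟩, _, ⟨q, rfl⟩, hpq, h⟩ := hcon D.down (R D) h
    refine hpq (congrArg _ ?_)
    rw [← Quotient.out_eq p, ← Quotient.out_eq q]
    exact Quotient.sound (s := r D.down) h
  have hU : #(⋃ D, R D) < #ι := by
    refine mk_iUnion_lt_of_lt_cof hι₀ ?_ hR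
    rw [mk_uLift]
    refine lt_of_le_of_lt ?_ hι
    have := lift_le.{u}.2 (mk_ultrafilter_le_beth_two V)
    simpa using this
  have hcode (α : ι) : ∃ (l : List (⋃ D, R D)) (g : V → ℕ),
      ∀ n, ∃ r : (⋃ D, R D), l[g n]? = some r ∧ x α n = x r n := by
    refine exists_list_of_forall_ultrafilter fun D => ?_
    refine ⟨Quotient.out (s := r D) ⟦α⟧, Set.mem_iUnion.2 ⟨⟨D⟩, _, rfl⟩, ?_⟩
    exact (r D).symm (Quotient.exact (Quotient.out_eq (s := r D) ⟦α⟧))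
  choose l g hlg using hcode
  have hinj : Function.Injective fun α => (l α, ULift.up.{u} (g α)) := by
    intro α β h
    obtain ⟨h₁, h₂⟩ := Prod.mk.inj h
    replace h₂ := ULift.up_injective h₂
    refine hx (funext fun n => ?_)
    obtain ⟨r, hr, e⟩ := hlg α n
    obtain ⟨s, hs, e'⟩ := hlg β n
    rw [h₁, h₂, hs] at hr
    rw [e, e', Option.some.inj hr]
  refine (mk_le_of_injective hinj).not_gt ?_
  rw [mk_prod, Cardinal.lift_id, Cardinal.lift_id, mk_uLift]
  refine mul_lt_of_lt hι₀ ((mk_list_le_max _).trans_lt (max_lt ?_ hU)) (lt_of_le_of_lt ?_ hι₂)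
  · exact (aleph0_le_beth 2).trans_lt hι₂
  · have := lift_le.{u}.2 (mk_fun_nat_le_beth_two V)
    simpa using this

/-! ### Representing elements by sections of a common colouring -/

/-- A measurable set of the product depends on countably many coordinates. -/
theorem exists_comp_mem_iff {J : Type*} [Infinite J] {s : Set (J → Bool)} (hs : MeasurableSet s) :
    ∃ (x : ℕ → J) (A : Set (ℕ → Bool)), x.Injective ∧ MeasurableSet A ∧
      ∀ z, z ∘ x ∈ A ↔ z ∈ s := by
  obtain ⟨S, t, hS, rfl⟩ := hs.eq_preimage_restrict_countable
  let S' : Set J := S ∪ Set.range (Infinite.natEmbedding J)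
  have : Countable S' := (hS.union (Set.countable_range _)).to_subtype
  have : Infinite S' :=
    ((Set.infinite_range_of_injective (Infinite.natEmbedding J).injective).mono
      Set.subset_union_right).to_subtype
  obtain ⟨e⟩ := nonempty_equiv_of_countable (α := ℕ) (β := S')
  have hx : Function.Injective fun n => (e n : J) := Subtype.val_injective.comp e.injective
  -- Filling up a sequence by a constant off `S'` is a measurable section of restriction to `S'`,
  -- and makes the witness measurable.
  let E (p : ℕ → Bool) : J → Bool := Function.extend (fun n => (e n : J)) p fun _ => false
  have hE : Measurable E := by
    refine measurable_pi_iff.2 fun i => ?_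
    by_cases hi : ∃ n, (e n : J) = i
    · obtain ⟨n, rfl⟩ := hi
      simpa [E, hx.extend_apply] using measurable_pi_apply n
    · simp [E, Function.extend_apply' _ _ _ hi]
  refine ⟨_, E ⁻¹' (S.domRestrict ⁻¹' t), hx, hE hs, fun z => ?_⟩
  have : S.domRestrict (E (z ∘ fun n => (e n : J))) = S.domRestrict z := by
    funext i
    have hi : ((e (e.symm ⟨i, Or.inl i.2⟩) : S') : J) = i := by simp
    have h := hx.extend_apply (z ∘ fun n => (e n : J)) (fun _ => false) (e.symm ⟨i, Or.inl i.2⟩)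
    simp only [hi, Function.comp_apply] at h
    exact h
  rw [Set.mem_preimage, Set.mem_preimage, this, Set.mem_preimage]

/-- Countably many elements of `M` distinguish the terms of an injective sequence of subsets. -/
theorem exists_separating_seq {M : Type*} {y : ℕ → Set M} (hy : y.Injective) :
    ∃ d : ℕ → M, ∀ m n, (∀ k, d k ∈ y m ↔ d k ∈ y n) → m = n := by
  have h₀ (q : ℕ × ℕ) : ∃ i : M, (i ∈ y q.1 ↔ i ∈ y q.2) → q.1 = q.2 := by
    by_cases hq : q.1 = q.2
    · have h₁ : y 0 ≠ y 1 := hy.ne zero_ne_one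
      have : Nonempty M := by
        by_contra h
        rw [not_nonempty_iff] at h
        exact h₁ (Subsingleton.elim _ _)
      exact ⟨Classical.arbitrary M, fun _ => hq⟩
    · by_contra! h
      exact hq (hy (Set.ext fun i => (h i).1))
  choose f hf using h₀
  refine ⟨fun k => f (Nat.unpair k), fun m n h => ?_⟩
  have h₁ := hf (m, n)
  have h₂ := h (Nat.pair m n)
  simp only [Nat.unpair_pair] at h₂
  exact h₁ h₂

/-- Many injective sequences in a set of size at most `2 ^ mu` are, together with one of few
labels, constant in the label and sections of one colouring. Each point of the set is regarded
as a subset of a set `M` of size `mu`; countably many elements of `M` suffice to distinguish the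
terms of a sequence, and the traces on them determine the index of a term. -/
theorem exists_colouring {ι J : Type u} {x : ι → ℕ → J} (hx : ∀ α, (x α).Injective)
    (A : ι → Set (ℕ → Bool)) {mu : Cardinal.{u}} (hmu : ℶ_ 2 ≤ mu) (hmu_pow : mu = mu ^ ℵ₀)
    (hcof : mu < (#ι).ord.cof) (hι : #ι ≤ 2 ^ mu) :
    ∃ (Y : Set ι) (c : J → ℕ) (B : Set (ℕ → Bool)), #Y = #ι ∧
      ∀ α ∈ Y, A α = B ∧ ∀ n, c (x α n) = n := by
  classical
  have hmu₀ : ℵ₀ ≤ mu := (aleph0_le_beth 2).trans hmu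
  have hι₀ : ℵ₀ ≤ #ι := hmu₀.trans (hcof.le.trans (cof_ord_le _))
  let K : Set J := ⋃ α, Set.range (x α)
  have hK : #K ≤ #(Set mu.out) := by
    rw [mk_set, mk_out]
    refine le_trans ?_ hι
    refine (mk_iUnion_le _).trans (mul_le_of_le hι₀ le_rfl (ciSup_le' fun α => ?_))
    exact (le_aleph0_iff_set_countable.2 (Set.countable_range (x α))).trans hι₀
  obtain ⟨e⟩ := hK
  let y (α : ι) (n : ℕ) : Set mu.out := e ⟨x α n, Set.mem_iUnion.2 ⟨α, n, rfl⟩⟩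
  have hy (α) : (y α).Injective := fun m n h => hx α (congrArg Subtype.val (e.injective h))
  choose d hd using fun α => exists_separating_seq (hy α)
  -- The trace of `d α` on the terms of `x α` records which index a term has, so sequences with
  -- the same code share terms only at equal indices.
  let code (α : ι) : (ℕ → mu.out) × ULift.{u} (Set (ℕ × ℕ)) × ULift.{u} (Set (ℕ → Bool)) :=
    (d α, ⟨{q | d α q.2 ∈ y α q.1}⟩, ⟨A α⟩)
  have h₁ : (2 : Cardinal.{u}) ^ ℵ₀ = ℶ_ 1 := by simp
  have h₂ : (2 : Cardinal.{u}) ^ (2 : Cardinal.{u}) ^ ℵ₀ = ℶ_ 2 := by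
    rw [h₁, ← beth_add_one, one_add_one_eq_two]
  have hcode : #((ℕ → mu.out) × ULift.{u} (Set (ℕ × ℕ)) × ULift.{u} (Set (ℕ → Bool))) ≤ mu := by
    rw [mk_prod, mk_prod]
    simp only [Cardinal.lift_id]
    refine mul_le_of_le hmu₀ ?_ (mul_le_of_le hmu₀ ?_ ?_)
    · simp [← hmu_pow]
    · refine le_trans ?_ ((beth_mono (by norm_num : (1 : Ordinal) ≤ 2)).trans hmu)
      simp
    · refine le_trans ?_ hmu
      rw [← h₂]
      simp
  obtain ⟨t, ht⟩ := infinite_pigeonhole code hι₀ (hcode.trans_lt hcof)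
  have hwd {α β : ι} (hα : code α = t) (hβ : code β = t) {m n : ℕ} (h : x α m = x β n) :
      m = n := by
    have h₀ : code α = code β := hα.trans hβ.symm
    have h₁ : d α = d β := congrArg Prod.fst h₀
    have h₂ : {q : ℕ × ℕ | d α q.2 ∈ y α q.1} = {q : ℕ × ℕ | d β q.2 ∈ y β q.1} :=
      congrArg (fun q => q.2.1.down) h₀
    have h₃ : y α m = y β n := by simp only [y, h]
    refine hd α m n fun k => ?_
    have h₄ : d α k ∈ y α n ↔ d β k ∈ y β n := Set.ext_iff.1 h₂ (n, k)
    rw [h₄, h₃, h₁]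
  let c (j : J) : ℕ := if h : ∃ n, ∃ α, code α = t ∧ x α n = j then h.choose else 0
  refine ⟨code ⁻¹' {t}, c, t.2.2.down, ht, fun α hα => ⟨?_, fun n => ?_⟩⟩
  · exact congrArg (fun q => q.2.2.down) (hα : code α = t)
  · have h : ∃ m, ∃ β, code β = t ∧ x β m = x α n := ⟨n, α, hα, rfl⟩
    obtain ⟨β, hβ, h'⟩ := h.choose_spec
    simp only [c, dif_pos h]
    exact hwd hβ hα h'

/-! ### Independent families in the Maharam algebra -/

theorem leb_inf_pattern {Ω : Type u} [MeasurableSpace Ω] {P : Measure Ω} {ι : Type*}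
    (S : ι → {s : Set Ω // MeasurableSet s}) (η : ι → Bool) (F : Finset ι) :
    MeasAlg.leb (F.inf fun α => if η α then MeasAlg.mk P (S α) else (MeasAlg.mk P (S α))ᶜ)
      = P {z | ∀ α ∈ F, (z ∈ (S α : Set Ω) ↔ η α = true)} := by
  classical
  have hm (F : Finset ι) :
      MeasurableSet {z | ∀ α ∈ F, (z ∈ (S α : Set Ω) ↔ η α = true)} := by
    simp only [Set.ofPred_forall]
    exact F.measurableSet_biInter fun α _ => (S α).2.iff (.const _)
  suffices h : (F.inf fun α => if η α then MeasAlg.mk P (S α) else (MeasAlg.mk P (S α))ᶜ)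
      = MeasAlg.mk P ⟨_, hm F⟩ by rw [h, MeasAlg.leb_mk]
  induction F using Finset.induction_on with
  | empty =>
    refine congrArg (MeasAlg.mk P) (Subtype.ext ?_)
    ext z
    simp
  | insert α F _ ih =>
    rw [Finset.inf_insert, ih]
    cases h : η α
    · simp only [Bool.false_eq_true, if_false, MeasAlg.mk_compl, MeasAlg.mk_inf]
      refine congrArg (MeasAlg.mk P) (Subtype.ext ?_)
      ext z
      simp [h]
    · simp only [if_true, MeasAlg.mk_inf]
      refine congrArg (MeasAlg.mk P) (Subtype.ext ?_)
      ext z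
      simp [h]

theorem finite_measAlg {Ω : Type u} [MeasurableSpace Ω] (P : Measure Ω) [Finite Ω] :
    Finite (MeasAlg P) :=
  Quotient.finite (nullSetoid P)

theorem exists_independent_subfamily {I : Type u} {mu : Cardinal.{u}} (hmu : ℶ_ 2 ≤ mu)
    (hmu_pow : mu = mu ^ ℵ₀) {ι : Type u} (hcof : mu < (#ι).ord.cof) (hι : #ι ≤ 2 ^ mu)
    {a : ι → MaharamAlgebra I} (ha : a.Injective) :
    ∃ X : Set ι, #X = #ι ∧ ∀ (s : Finset ι) (η : ι → Bool), (s : Set ι) ⊆ X →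
      0 < MeasAlg.leb (s.inf fun α => if η α then a α else (a α)ᶜ) := by
  classical
  have hι₀ : ℵ₀ ≤ #ι :=
    (aleph0_le_beth 2).trans (hmu.trans (hcof.le.trans (cof_ord_le _)))
  have : Infinite ι := infinite_iff.2 hι₀
  -- Over a finite index set the algebra is finite and has no family of size `#ι`.
  have : Infinite I := by
    by_contra h
    rw [not_infinite_iff_finite] at h
    have := finite_measAlg (Measure.infinitePi fun _ : I => coin)
    exact not_finite_iff_infinite.2 ‹Infinite ι› (Finite.of_injective a ha)
  obtain ⟨S, hS⟩ : ∃ S : ι → {s : Set (I → Bool) // MeasurableSet s},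
      ∀ α, a α = MeasAlg.mk _ (S α) := by
    refine ⟨fun α => (a α).out, fun α => (Quotient.out_eq (a α)).symm⟩
  choose x A hx hA hxA using fun α => exists_comp_mem_iff (S α).2
  obtain ⟨Y, c, B, hY, hc⟩ := exists_colouring hx A hmu hmu_pow hcof hι
  have : Nonempty Y := mk_ne_zero_iff.1 (hY ▸ (aleph0_pos.trans_le hι₀).ne')
  have hB : MeasurableSet B := by
    obtain ⟨α, hα⟩ := this
    exact (hc α hα).1 ▸ hA α
  have hSB {α : ι} (hα : α ∈ Y) (z : I → Bool) : z ∈ (S α : Set (I → Bool)) ↔ z ∘ x α ∈ B := by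
    rw [← hxA, (hc α hα).1]
  have hinj : Function.Injective fun (α : Y) (n : essentialCoords B) => x α n := by
    intro α β h
    refine Subtype.ext (ha ?_)
    rw [hS, hS, MeasAlg.mk_eq_mk]
    refine Filter.eventuallyEq_set.2 ?_
    filter_upwards [comp_mem_ae_iff_of_eqOn_essentialCoords hB (hc α α.2).2 (hc β β.2).2
      fun n hn => congrFun h ⟨n, hn⟩] with z hz
    rw [hSB α.2, hSB β.2, hz]
  obtain ⟨D, X, hX, hD⟩ := exists_ultrafilter_separating hinj
    (hY ▸ hmu.trans_lt hcof)
  refine ⟨Subtype.val '' X, ?_, fun s η hs => ?_⟩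
  · rw [mk_image_eq Subtype.val_injective, hX, hY]
  · let F : Finset Y := s.subtype (· ∈ Y)
    have hFX {α : Y} (hα : α ∈ F) : α ∈ X := by
      obtain ⟨β, hβ, h⟩ := hs (Finset.mem_subtype.1 hα)
      exact Subtype.ext h ▸ hβ
    have hn : ∀ᶠ n : essentialCoords B in D, ∀ α ∈ F, ∀ β ∈ F, α ≠ β → x α n ≠ x β n := by
      rw [Filter.eventually_all_finset]
      intro α hα
      rw [Filter.eventually_all_finset]
      intro β hβ
      rw [Filter.eventually_imp_distrib_left]
      exact hD α (hFX hα) β (hFX hβ)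
    obtain ⟨n, hn⟩ := hn.exists
    have h := measure_pattern_ne_zero hB F (x := fun α : Y => x α) (fun α => (hc α α.2).2) n.2
      (fun α hα β hβ h => by_contra fun h' => hn α hα β hβ h' h) fun α => η α
    simp only [hS]
    rw [leb_inf_pattern, pos_iff_ne_zero]
    convert h using 3
    ext z
    constructor
    · intro hz α hα
      rw [← hSB α.2]
      exact hz α (Finset.mem_subtype.1 hα)
    · intro hz α hα
      obtain ⟨β, -, rfl⟩ := hs hα
      rw [hSB β.2]
      exact hz β (Finset.mem_subtype.2 hα)

theorem mainTheorem7 (I : Type u) (lam mu : Cardinal.{u})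
    (hmu : ℶ_ 2 ≤ mu) (hmu_pow : mu = mu ^ ℵ₀)
    (hcof : mu < lam.ord.cof) (hlam : lam ≤ 2 ^ mu) :
    (∀ (ι : Type u) (a : ι → MaharamAlgebra I), #ι = lam →
      Function.Injective a → (∀ α, 0 < (a α).leb) →
      ∃ X : Set ι, #X = lam ∧
        ∀ (s : Finset ι) (η : ι → Bool), (s : Set ι) ⊆ X →
          0 < MeasAlg.leb (s.inf fun α => if η α then a α else (a α)ᶜ)) ∧
    IsFreeCaliber (MaharamAlgebra I) lam := by
  classical
  refine ⟨?_, ?_⟩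
  · rintro ι a rfl ha -
    exact exists_independent_subfamily hmu hmu_pow hcof hlam ha
  · rintro Z rfl
    obtain ⟨X, hX, h⟩ := exists_independent_subfamily hmu hmu_pow hcof hlam
      (Subtype.val_injective (p := (· ∈ Z)))
    refine ⟨Subtype.val '' X, Subtype.coe_image_subset _ _,
      (mk_image_eq Subtype.val_injective).trans hX, fun s η hs => ?_⟩
    have hsZ {y} (hy : y ∈ s) : y ∈ Z := Subtype.coe_image_subset _ _ (hs hy)
    have h₁ := h (s.subtype (· ∈ Z)) (fun y => η y) fun y hy => by
      obtain ⟨w, hw, e⟩ := hs (Finset.mem_subtype.1 hy)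
      exact Subtype.ext e ▸ hw
    rw [MeasAlg.leb_pos_iff] at h₁
    convert h₁ using 1
    conv_lhs => rw [← Finset.subtype_map_of_mem (p := (· ∈ Z)) fun y hy => hsZ hy]
    rw [Finset.inf_map]
    rfl
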